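/- Let $(\mathcal C,\otimes,\mathbb I)$ be a locally presentable, closed symmetric monoidal category with internal hom $[-,-]$, and let $(F,\nabla,\eta)$ be an accessible lax symmetric monoidal endofunctor of $\mathcal C$. Write $\mathsf{Alg}$ and $\mathsf{CoAlg}$ for the categories of $F$-algebras and $F$-coalgebras. For a coalgebra $(C,\chi)$ and algebras $(A,\alpha)$, $(B,\beta)$, a morphism $\phi\colon C\otimes A\to B$ of $\mathcal C$ is a *measuring* if $$\beta\circ F(\phi)\circ\nabla_{C,A}\circ(\chi\otimes \mathrm{id}_{FA})=\phi\circ(\mathrm{id}_C\otimes\alpha)\colon C\otimes FA\to B .$$ The measurings from $A$ to $B$ form a category: its objects are the pairs $(C;f)$ of a coalgebra $C$ and a measuring $f\colon C\otimes A\to B$, and a morphism $(C;f)\to(D;g)$ is a coalgebra homomorphism $d\colon C\to D$ with $f=g\circ(d\otimes \mathrm{id}_A)$. A terminal object of it is called a *universal measuring* from $A$ to $B$, and its coalgebra is denoted $\underline{\mathsf{Alg}}(A,B)$. The *convolution algebra* $[C,B]$ is the internal hom $[C,B]$ with the structure map $$F[C,B]\to[FC,FB]\to[C,B],$$ where the first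 map is adjunct to $F[C,B]\otimes FC\xrightarrow{\nabla}F([C,B]\otimes C)\xrightarrow{F(\mathrm{ev})}FB$ and the second precomposes with $\chi$ and postcomposes with $\beta$. Then $\mathsf{Alg}$ has an initial object, and a universal measuring from $A$ to $B$ exists for all algebras $A$ and $B$, so that $\underline{\mathsf{Alg}}(-,-)$ is a functor $\mathsf{Alg}^{\mathrm{op}}\times\mathsf{Alg}\to\mathsf{CoAlg}$. Let $N$ be an initial algebra, let $C$ be a coalgebra, and let $C^*=[C,N]$ be the dual algebra of $C$. 1. The algebra $C^*$ has the universal property $$\mathsf{Alg}(A,C^*)\;\cong\;\lim_{X\in\mathsf{Alg}}\mathsf{CoAlg}\bigl(C,\underline{\mathsf{Alg}}(A,X)\bigr),$$ naturally in $A\in\mathsf{Alg}$, where the limit of sets on the right is taken over the category of all algebras $X$. 2. Let $A$ be a $C$-initial algebra, that is, an algebra such that for every algebra $X$ there is a unique coalgebra homomorphism $C\to\underline{\mathsf{Alg}}(A,X)$. Then there is a unique algebra homomorphism $A\to C^*$. -/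

import Mathlib

open CategoryTheory MonoidalCategory Limits Opposite

universe v u

namespace MeasuringCoalgebra

variable {𝒞 : Type u} [Category.{v} 𝒞] [MonoidalCategory 𝒞]

section Measurings

variable {F : 𝒞 ⥤ 𝒞} [F.LaxMonoidal]

/-- A morphism `φ : C ⊗ A ⟶ B` from the tensor product of (the carriers of) a coalgebra `C` and an
algebra `A` to an algebra `B` is a measuring if the two maps `C ⊗ F A ⟶ B`
`C ⊗ F A ⟶ F C ⊗ F A ⟶ F (C ⊗ A) ⟶ F B ⟶ B` and `C ⊗ F A ⟶ C ⊗ A ⟶ B` agree. -/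
def IsMeasuring (C : Endofunctor.Coalgebra F) (A B : Endofunctor.Algebra F)
    (φ : C.V ⊗ A.a ⟶ B.a) : Prop :=
  C.str ▷ F.obj A.a ≫ Functor.LaxMonoidal.μ F C.V A.a ≫ F.map φ ≫ B.str = C.V ◁ A.str ≫ φ

/-- Precomposing a measuring `C ⊗ A ⟶ B` with an algebra homomorphism `A' ⟶ A` and postcomposing
it with an algebra homomorphism `B ⟶ B'` gives a measuring. -/
lemma IsMeasuring.change {C : Endofunctor.Coalgebra F} {A A' B B' : Endofunctor.Algebra F}
    {φ : C.V ⊗ A.a ⟶ B.a} (h : IsMeasuring C A B φ) (a : A' ⟶ A) (b : B ⟶ B') :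
    IsMeasuring C A' B' (C.V ◁ a.f ≫ φ ≫ b.f) := by
  unfold IsMeasuring at h ⊢
  have e : C.str ▷ F.obj A'.a ≫ Functor.LaxMonoidal.μ F C.V A'.a ≫ F.map (C.V ◁ a.f) =
      C.V ◁ F.map a.f ≫ C.str ▷ F.obj A.a ≫ Functor.LaxMonoidal.μ F C.V A.a := by
    rw [← Functor.LaxMonoidal.μ_natural_right, ← whisker_exchange_assoc]
  simp only [Functor.map_comp, Category.assoc, Endofunctor.Algebra.Hom.h]
  rw [reassoc_of% e, reassoc_of% h, ← whiskerLeft_comp_assoc, ← whiskerLeft_comp_assoc, a.h]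

/-- The objects of the category of measurings from `A` to `B`: pairs `(C; f)` of a coalgebra `C`
and a measuring `f : C ⊗ A ⟶ B`. -/
structure Measuring (A B : Endofunctor.Algebra F) where
  /-- the coalgebra of the pair -/
  coalg : Endofunctor.Coalgebra F
  /-- the underlying morphism of the measuring -/
  map : coalg.V ⊗ A.a ⟶ B.a
  /-- it is a measuring -/
  isMeasuring : IsMeasuring coalg A B map

namespace Measuring

/-- A morphism `(C; f) ⟶ (D; g)` of measurings is a coalgebra homomorphism `d : C ⟶ D`
with `f = g ∘ (d ⊗ A)`. -/
@[ext]
structure Hom {A B : Endofunctor.Algebra F} (M M' : Measuring A B) where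
  /-- the coalgebra homomorphism -/
  hom : M.coalg ⟶ M'.coalg
  /-- compatibility with the measurings -/
  comm : hom.f ▷ A.a ≫ M'.map = M.map

instance (A B : Endofunctor.Algebra F) : Category (Measuring A B) where
  Hom M M' := Hom M M'
  id M := ⟨𝟙 M.coalg, by simp⟩
  comp f g := ⟨f.hom ≫ g.hom, by simp [g.comm, f.comm]⟩
  id_comp _ := Hom.ext (Category.id_comp _)
  comp_id _ := Hom.ext (Category.comp_id _)
  assoc _ _ _ := Hom.ext (Category.assoc _ _ _)

end Measuring

/-- A universal measuring from `A` to `B`: a terminal object of the category of measurings.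
Its coalgebra is the coalgebra `Alg(A, B)` of partial homomorphisms, and its measuring is the
evaluation `Alg(A, B) ⊗ A ⟶ B`. -/
structure UniversalMeasuring (A B : Endofunctor.Algebra F) where
  /-- the measuring -/
  obj : Measuring A B
  /-- it is terminal -/
  isTerminal : IsTerminal obj

namespace UniversalMeasuring

variable {A B : Endofunctor.Algebra F} (U : UniversalMeasuring A B)

/-- The coalgebra homomorphism `C ⟶ Alg(A, B)` classifying a measuring `φ : C ⊗ A ⟶ B`. -/
def lift {C : Endofunctor.Coalgebra F} {φ : C.V ⊗ A.a ⟶ B.a} (h : IsMeasuring C A B φ) :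
    C ⟶ U.obj.coalg :=
  (U.isTerminal.from ⟨C, φ, h⟩).hom

lemma lift_comm {C : Endofunctor.Coalgebra F} {φ : C.V ⊗ A.a ⟶ B.a} (h : IsMeasuring C A B φ) :
    (U.lift h).f ▷ A.a ≫ U.obj.map = φ :=
  (U.isTerminal.from ⟨C, φ, h⟩).comm

lemma lift_comm_assoc {C : Endofunctor.Coalgebra F} {φ : C.V ⊗ A.a ⟶ B.a}
    (h : IsMeasuring C A B φ) {Z : 𝒞} (k : B.a ⟶ Z) :
    (U.lift h).f ▷ A.a ≫ U.obj.map ≫ k = φ ≫ k := by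
  rw [← Category.assoc, lift_comm]

lemma lift_unique {C : Endofunctor.Coalgebra F} {φ : C.V ⊗ A.a ⟶ B.a} (h : IsMeasuring C A B φ)
    (d : C ⟶ U.obj.coalg) (hd : d.f ▷ A.a ≫ U.obj.map = φ) : d = U.lift h :=
  congrArg Measuring.Hom.hom (U.isTerminal.hom_ext (⟨d, hd⟩ : Measuring.Hom ⟨C, φ, h⟩ U.obj)
    (U.isTerminal.from ⟨C, φ, h⟩))

end UniversalMeasuring

/-- The functor `(A, B) ↦ Alg(A, B)` from algebras to coalgebras, contravariant in the first and
covariant in the second variable. For `a : A' ⟶ A` and `b : B ⟶ B'`, the homomorphism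
`Alg(A, B) ⟶ Alg(A', B')` is the one classifying the measuring
`Alg(A, B) ⊗ A' ⟶ Alg(A, B) ⊗ A ⟶ B ⟶ B'`. -/
abbrev homCoalgebra (U : ∀ A B : Endofunctor.Algebra F, UniversalMeasuring A B) :
    (Endofunctor.Algebra F)ᵒᵖ ⥤ Endofunctor.Algebra F ⥤ Endofunctor.Coalgebra F where
  obj A :=
    { obj := fun B => (U A.unop B).obj.coalg
      map := fun {B B'} b =>
        (U A.unop B').lift ((U A.unop B).obj.isMeasuring.change (𝟙 A.unop) b)
      map_id := fun B => by
        symm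
        apply UniversalMeasuring.lift_unique
        simp
      map_comp := fun {B B' B''} b b' => by
        symm
        apply UniversalMeasuring.lift_unique
        simp [UniversalMeasuring.lift_comm, UniversalMeasuring.lift_comm_assoc] }
  map {A A'} a :=
    { app := fun B =>
        (U A'.unop B).lift ((U A.unop B).obj.isMeasuring.change a.unop (𝟙 B))
      naturality := fun B B' b => by
        have h := UniversalMeasuring.lift_unique (U A'.unop B')
          ((U A.unop B).obj.isMeasuring.change a.unop b)
        refine (h _ ?_).trans (h _ ?_).symm
        · simp [UniversalMeasuring.lift_comm, ← whisker_exchange_assoc]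
        · simp [UniversalMeasuring.lift_comm, UniversalMeasuring.lift_comm_assoc] }
  map_id A := by
    ext1
    ext1 B
    symm
    apply UniversalMeasuring.lift_unique
    simp
  map_comp {A A' A''} a a' := by
    ext1
    ext1 B
    symm
    apply UniversalMeasuring.lift_unique
    simp [UniversalMeasuring.lift_comm, ← whisker_exchange_assoc]

/-- The presheaf `A ↦ lim_X CoAlg(C, Alg(A, X))` on the category of algebras. The limit, over the
category of all algebras `X`, of the sets `CoAlg(C, Alg(A, X))` is the set of compatible families
`(s_X : C ⟶ Alg(A, X))_X`. -/
def weightedLimitPresheaf (U : ∀ A B : Endofunctor.Algebra F, UniversalMeasuring A B)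
    (C : Endofunctor.Coalgebra F) : (Endofunctor.Algebra F)ᵒᵖ ⥤ Type (max u v) :=
  homCoalgebra U ⋙ (Functor.whiskeringRight _ _ _).obj (coyoneda.obj (op C)) ⋙
    Functor.sectionsFunctor (Endofunctor.Algebra F)

/-- An algebra `A` is `C`-initial if for every algebra `X` there is a unique coalgebra homomorphism
`C ⟶ Alg(A, X)`. -/
def IsCInitial (U : ∀ A B : Endofunctor.Algebra F, UniversalMeasuring A B)
    (C : Endofunctor.Coalgebra F) (A : Endofunctor.Algebra F) : Prop :=
  ∀ X : Endofunctor.Algebra F, Nonempty (Unique (C ⟶ (U A X).obj.coalg))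

end Measurings

section Convolution

variable [MonoidalClosed 𝒞]

/-- The lax closed structure `F [X, Y] ⟶ [F X, F Y]` of a lax monoidal endofunctor `F`, adjunct to
`F X ⊗ F [X, Y] ⟶ F (X ⊗ [X, Y]) ⟶ F Y`. -/
noncomputable def laxClosed (F : 𝒞 ⥤ 𝒞) [F.LaxMonoidal] (X Y : 𝒞) :
    F.obj ((ihom X).obj Y) ⟶ (ihom (F.obj X)).obj (F.obj Y) :=
  MonoidalClosed.curry
    (Functor.LaxMonoidal.μ F X ((ihom X).obj Y) ≫ F.map ((ihom.ev X).app Y))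

variable {F : 𝒞 ⥤ 𝒞} [F.LaxMonoidal]

/-- The convolution algebra `[C, B]` of a coalgebra `C` and an algebra `B`: the internal hom with
structure map `F [C, B] ⟶ [F C, F B] ⟶ [C, B]`, where the second map precomposes with the structure
map of `C` and postcomposes with that of `B`. -/
noncomputable abbrev convolution (C : Endofunctor.Coalgebra F) (B : Endofunctor.Algebra F) :
    Endofunctor.Algebra F where
  a := (ihom C.V).obj B.a
  str := laxClosed F C.V B.a ≫ (MonoidalClosed.pre C.str).app (F.obj B.a) ≫
    (ihom C.V).map B.str

end Convolution

end MeasuringCoalgebra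

namespace CategoryTheory.Endofunctor

namespace Coalgebra

variable {𝒞 : Type u} [Category.{v} 𝒞] {F : 𝒞 ⥤ 𝒞} {J : Type*} [Category* J]

/-- The leg at `j` of a cocone on the carriers of a diagram of coalgebras. -/
def leg {K : J ⥤ Coalgebra F} (c : Cocone (K ⋙ forget F)) (j : J) : (K.obj j).V ⟶ c.pt :=
  c.ι.app j

lemma map_leg {K : J ⥤ Coalgebra F} (c : Cocone (K ⋙ forget F)) {i j : J} (f : i ⟶ j) :
    (K.map f).f ≫ leg c j = leg c i :=
  c.w f

section Desc

variable {K : J ⥤ Coalgebra F} {c : Cocone (K ⋙ forget F)} (hc : IsColimit c)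

include hc in
lemma leg_hom_ext {Y : 𝒞} {g h : c.pt ⟶ Y} (w : ∀ j, leg c j ≫ g = leg c j ≫ h) : g = h :=
  hc.hom_ext w

/-- The morphism out of a colimit of carriers induced by a compatible family. -/
def descLeg {Y : 𝒞} (x : ∀ j, (K.obj j).V ⟶ Y)
    (hx : ∀ {i j : J} (f : i ⟶ j), (K.map f).f ≫ x j = x i) : c.pt ⟶ Y :=
  hc.desc
    { pt := Y
      ι :=
        { app := x
          naturality := fun _ _ f => (hx f).trans (Category.comp_id _).symm } }

lemma leg_descLeg {Y : 𝒞} (x : ∀ j, (K.obj j).V ⟶ Y)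
    (hx : ∀ {i j : J} (f : i ⟶ j), (K.map f).f ≫ x j = x i) (j : J) :
    leg c j ≫ descLeg hc x hx = x j :=
  hc.fac _ j

/-- The structure map of a colimit of coalgebras. -/
def colimitStr : c.pt ⟶ F.obj c.pt :=
  descLeg hc (fun j => (K.obj j).str ≫ F.map (leg c j)) (fun f => by
    rw [← Hom.h_assoc, ← F.map_comp, map_leg])

lemma leg_colimitStr (j : J) : leg c j ≫ colimitStr hc = (K.obj j).str ≫ F.map (leg c j) :=
  hc.fac _ j

/-- The cocone of coalgebras on a colimit cocone of the carriers. -/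
def coconeOfIsColimit : Cocone K where
  pt := ⟨c.pt, colimitStr hc⟩
  ι :=
    { app := fun j =>
        { f := leg c j
          h := (leg_colimitStr hc j).symm }
      naturality := fun i j f => by
        ext
        exact (map_leg c f).trans (Category.comp_id _).symm }

/-- The cocone `coconeOfIsColimit` is a colimit. -/
def isColimitCoconeOfIsColimit : IsColimit (coconeOfIsColimit hc) :=
  have w (s : Cocone K) {i j : J} (f : i ⟶ j) :
      (K.map f).f ≫ Hom.f (V₁ := s.pt) (s.ι.app j) = Hom.f (V₁ := s.pt) (s.ι.app i) :=
    congrArg Hom.f (s.w f)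
  { desc s :=
      { f := descLeg hc (fun j => Hom.f (V₁ := s.pt) (s.ι.app j)) (w s)
        h := leg_hom_ext hc fun j => by
          have h := Hom.h (V₁ := s.pt) (s.ι.app j)
          rw [← leg_descLeg hc _ (w s) j, F.map_comp, Category.assoc] at h
          refine (Category.assoc _ _ _).symm.trans (Eq.trans ?_ h)
          rw [← Category.assoc]
          exact congrArg (· ≫ _) (leg_colimitStr hc j) }
    fac s j := by
      ext1
      exact leg_descLeg hc _ (w s) j
    uniq s m hm := by
      ext1
      exact leg_hom_ext hc fun j =>
        (congrArg Hom.f (hm j)).trans (leg_descLeg hc _ (w s) j).symm }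

end Desc

instance : CreatesColimitsOfShape J (forget F) where
  CreatesColimit := createsColimitOfReflectsIso fun _ hc =>
    { liftedCocone := coconeOfIsColimit hc
      validLift := Cocone.ext (Iso.refl _) fun _ => Category.comp_id _
      makesColimit := isColimitCoconeOfIsColimit hc }

instance [HasColimitsOfShape J 𝒞] : HasColimitsOfShape J (Coalgebra F) :=
  hasColimitsOfShape_of_hasColimitsOfShape_createsColimitsOfShape (forget F)

instance [HasColimitsOfShape J 𝒞] : PreservesColimitsOfShape J (forget F) where

instance [HasColimitsOfSize.{v, v} 𝒞] : HasColimitsOfSize.{v, v} (Coalgebra F) where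

/-- A coalgebra `V` is recursive if for every algebra `X` there is a unique morphism `x : V ⟶ X`
with `x = X.str ∘ F x ∘ V.str`. -/
def IsRecursive (V : Coalgebra F) : Prop :=
  ∀ X : Algebra F, ∃! x : V.V ⟶ X.a, V.str ≫ F.map x ≫ X.str = x

lemma IsRecursive.of_iso {V W : Coalgebra F} (h : IsRecursive V) (e : V ≅ W) : IsRecursive W := by
  intro X
  obtain ⟨x, hx, hu⟩ := h X
  have e₂ : e.inv.f ≫ e.hom.f = 𝟙 _ := congrArg Hom.f e.inv_hom_id
  refine ⟨e.inv.f ≫ x, ?_, fun y hy => ?_⟩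
  · dsimp only at hx ⊢
    rw [F.map_comp, Category.assoc, Hom.h_assoc, hx]
  · dsimp only at hy hu
    rw [← hu (e.hom.f ≫ y) ?_, reassoc_of% e₂]
    rw [F.map_comp, Category.assoc, Hom.h_assoc, hy]

lemma IsRecursive.of_isColimit {K : J ⥤ Coalgebra F} (hK : ∀ j, IsRecursive (K.obj j))
    {c : Cocone K} (hc : IsColimit ((forget F).mapCocone c)) : IsRecursive c.pt := by
  intro X
  choose x hx hu using fun j => hK j X
  dsimp only at hx hu
  have hf {i j : J} (f : i ⟶ j) : (K.map f).f ≫ x j = x i := by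
    apply hu i
    rw [F.map_comp, Category.assoc, Hom.h_assoc, hx]
  obtain ⟨ι, hι⟩ : ∃ ι : ∀ j, K.obj j ⟶ c.pt, ∀ j, ι j = c.ι.app j :=
    ⟨fun j => c.ι.app j, fun _ => rfl⟩
  obtain ⟨d, hd⟩ : ∃ d : c.pt.V ⟶ X.a, ∀ j, (ι j).f ≫ d = x j :=
    ⟨descLeg hc x hf, fun j => by rw [hι]; exact leg_descLeg hc x hf j⟩
  have ext {y z : c.pt.V ⟶ X.a} (w : ∀ j, (ι j).f ≫ y = (ι j).f ≫ z) : y = z :=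
    leg_hom_ext hc fun j => by
      have h := w j
      rw [hι] at h
      exact h
  refine ⟨d, ext fun j => ?_, fun y hy => ext fun j => ?_⟩
  · rw [← Hom.h_assoc, ← F.map_comp_assoc, hd]
    exact hx j
  · rw [hd]
    apply hu j
    dsimp only at hy
    rw [F.map_comp, Category.assoc, Hom.h_assoc, hy]

/-- The coalgebra `F V` of a coalgebra `V`. -/
@[simps]
def next (V : Coalgebra F) : Coalgebra F where
  V := F.obj V.V
  str := F.map V.str

lemma IsRecursive.next {V : Coalgebra F} (h : IsRecursive V) : IsRecursive V.next := by
  intro X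
  obtain ⟨x, hx, hu⟩ := h X
  dsimp only at hx hu
  change ∃! y : F.obj V.V ⟶ X.a, F.map V.str ≫ F.map y ≫ X.str = y
  refine ⟨F.map x ≫ X.str, ?_, fun y hy => ?_⟩
  · dsimp only
    rw [← F.map_comp_assoc, hx]
  · dsimp only at hy
    rw [← F.map_comp_assoc] at hy
    rw [← hu (V.str ≫ y), hy]
    rw [hy]

/-- The algebra of a coalgebra with invertible structure map is initial when the coalgebra
is recursive. -/
noncomputable def IsRecursive.isInitial {V : Coalgebra F} (h : IsRecursive V) [IsIso V.str] :
    IsInitial (⟨V.V, inv V.str⟩ : Algebra F) :=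
  IsInitial.ofUniqueHom
    (fun X =>
      { f := (h X).choose
        h := by
          have h := (h X).choose_spec.1
          dsimp only at h ⊢
          rw [IsIso.eq_inv_comp]
          exact h })
    (fun X m => by
      ext
      apply (h X).choose_spec.2
      rw [← IsIso.eq_inv_comp]
      exact m.h)

/-- The data of the transfinite iteration of `F`, starting from the initial coalgebra. -/
noncomputable def succStruct (F : 𝒞 ⥤ 𝒞) [HasInitial (Coalgebra F)] :
    SmallObject.SuccStruct (Coalgebra F) where
  X₀ := ⊥_ _
  succ := next
  toSucc V := { f := V.str }

section Iteration

variable {K : Type v} [LinearOrder K] [OrderBot K] [SuccOrder K] [WellFoundedLT K]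
  [HasColimitsOfSize.{v, v} 𝒞]

variable (F K) in
/-- The initial chain of `F` of length `K`. -/
noncomputable abbrev initialChain : K ⥤ Coalgebra F := (succStruct F).iterationFunctor K

lemma isRecursive_initialChain (j : K) : IsRecursive ((initialChain F K).obj j) := by
  induction j using SuccOrder.limitRecOn with
  | isMin j hj =>
    obtain rfl := hj.eq_bot
    have h : IsRecursive (⊥_ (Coalgebra F)) :=
      .of_isColimit (K := Functor.empty _) (fun j => j.as.elim)
        (isColimitOfPreserves (forget F) (colimit.isColimit _))
    exact h.of_iso ((succStruct F).iterationFunctorObjBotIso K).symm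
  | succ j hj hr =>
    exact hr.next.of_iso ((succStruct F).iterationFunctorObjSuccIso j hj).symm
  | isSuccLimit j hj hr =>
    exact .of_isColimit (fun i => hr i.1 i.2)
      (isColimitOfPreserves (forget F)
        ((initialChain F K).isColimitOfIsWellOrderContinuous j hj))

/-- The structure map of the colimit of the initial chain is invertible if `F` preserves
this colimit. -/
lemma isIso_str_iteration [NoMaxOrder K] [PreservesColimitsOfShape K F] :
    IsIso ((succStruct F).iteration K).str := by
  have hc := isColimitOfPreserves (forget F) ((succStruct F).isColimitIterationCocone K)
  have hc' := isColimitOfPreserves F hc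
  obtain ⟨W, hW⟩ : ∃ W, W = initialChain F K := ⟨_, rfl⟩
  obtain ⟨T, hT⟩ : ∃ T, T = (succStruct F).iteration K := ⟨_, rfl⟩
  have hι : ∃ ι : ∀ j, W.obj j ⟶ T, (∀ {i j : K} (h : i ⟶ j), W.map h ≫ ι j = ι i) ∧
      (∀ {Y : 𝒞} {y z : T.V ⟶ Y}, (∀ j, (ι j).f ≫ y = (ι j).f ≫ z) → y = z) ∧
      (∀ {Y : 𝒞} {y z : F.obj T.V ⟶ Y},
        (∀ j, F.map (ι j).f ≫ y = F.map (ι j).f ≫ z) → y = z) ∧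
      ∀ {Y : 𝒞} (x : ∀ j, F.obj (W.obj j).V ⟶ Y),
        (∀ {i j : K} (h : i ⟶ j), F.map (W.map h).f ≫ x j = x i) →
          ∃ y : F.obj T.V ⟶ Y, ∀ j, F.map (ι j).f ≫ y = x j := by
    subst hW hT
    exact ⟨fun j => ((succStruct F).iterationCocone K).ι.app j,
      ((succStruct F).iterationCocone K).w, fun w => hc.hom_ext w, fun w => hc'.hom_ext w,
      fun {Y} x hx =>
        let s : Cocone ((initialChain F K ⋙ forget F) ⋙ F) :=
          ⟨Y, { app := x, naturality := fun _ _ h => (hx h).trans (Category.comp_id _).symm }⟩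
        ⟨hc'.desc s, hc'.fac s⟩⟩
  have he : ∃ e : ∀ j : K, F.obj (W.obj j).V ⟶ (W.obj (Order.succ j)).V,
      (∀ j, (W.obj j).str ≫ e j = (W.map (homOfLE (Order.le_succ j))).f) ∧
      ∀ j, F.map (W.obj j).str ≫ F.map (e j) = e j ≫ (W.obj (Order.succ j)).str := by
    subst hW
    exact ⟨fun j => ((succStruct F).iterationFunctorObjSuccIso j (not_isMax j)).inv.f,
      fun j => (congrArg Hom.f ((succStruct F).iterationFunctor_map_succ j (not_isMax j))).symm,
      fun j => ((succStruct F).iterationFunctorObjSuccIso j (not_isMax j)).inv.h⟩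
  rw [← hT]
  clear hc hc' hW hT
  obtain ⟨ι, hι, ext, ext', desc⟩ := hι
  obtain ⟨e, he, hes⟩ := he
  have hι' {i j : K} (h : i ⟶ j) : (W.map h).f ≫ (ι j).f = (ι i).f := congrArg Hom.f (hι h)
  obtain ⟨g, hg⟩ := desc (fun j => e j ≫ (ι (Order.succ j)).f) (by
    intro i j h
    obtain hij | hij := (leOfHom h).eq_or_lt
    · subst hij
      obtain rfl : h = 𝟙 _ := Subsingleton.elim _ _
      simp
    · have h₁ : W.map h = W.map (homOfLE (Order.le_succ i)) ≫
          W.map (homOfLE (Order.succ_le_of_lt hij)) := by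
        rw [← W.map_comp]
        rfl
      rw [h₁, comp_f, F.map_comp, ← he, F.map_comp, hes, Category.assoc, Category.assoc,
        Hom.h_assoc, reassoc_of% he, hι', hι'])
  refine ⟨g, ext fun j => ?_, ext' fun j => ?_⟩
  · rw [← Hom.h_assoc, hg, reassoc_of% he, hι', Category.comp_id]
  · rw [reassoc_of% hg, Category.comp_id, ← Hom.h, ← reassoc_of% hes,
      ← F.map_comp, ← F.map_comp, reassoc_of% he, hι']

lemma hasInitial_algebra [NoMaxOrder K] [PreservesColimitsOfShape K F] :
    HasInitial (Algebra F) := by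
  have := isIso_str_iteration (F := F) (K := K)
  have h : IsRecursive ((succStruct F).iteration K) := .of_isColimit isRecursive_initialChain
    (isColimitOfPreserves (forget F) ((succStruct F).isColimitIterationCocone K))
  exact h.isInitial.hasInitial

end Iteration

lemma hasInitial_algebra_of_isAccessible [HasColimitsOfSize.{v, v} 𝒞] [F.IsAccessible.{v}] :
    HasInitial (Algebra F) := by
  obtain ⟨κ, hκ, _⟩ := Functor.IsAccessible.exists_cardinal (F := F)
  have hκ' := Cardinal.IsRegular.aleph0_le hκ.out
  have := Cardinal.noMaxOrder hκ'
  have : Nonempty κ.ord.ToType := Ordinal.nonempty_toType_iff.2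
    (by simpa using (Cardinal.aleph0_pos.trans_le hκ').ne')
  let : OrderBot κ.ord.ToType := WellFoundedLT.toOrderBot _
  let : SuccOrder κ.ord.ToType := SuccOrder.ofLinearWellFoundedLT _
  have := F.preservesColimitsOfShape_of_isCardinalAccessible κ κ.ord.ToType
  exact hasInitial_algebra (K := κ.ord.ToType)

end Coalgebra
end CategoryTheory.Endofunctor

namespace CategoryTheory

lemma hasCardinalLT_arrow_nat {κ : Cardinal.{v}} (hκ : Cardinal.aleph0 < κ) :
    HasCardinalLT (Arrow ℕ) κ := by
  have : Function.Injective (fun f : Arrow ℕ => (f.left, f.right)) := by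
    intro f g h
    obtain ⟨h₁, h₂⟩ := Prod.mk.inj h
    exact Arrow.ext h₁ h₂ (Subsingleton.elim _ _)
  have : Countable (Arrow ℕ) := this.countable
  exact lt_of_le_of_lt (by simp) ((Cardinal.lift_lt.{v, 0}).2 hκ)

namespace Endofunctor.Coalgebra

variable {𝒞 : Type u} [Category.{v} 𝒞] {F : 𝒞 ⥤ 𝒞}

/-- A stage in the construction of a subcoalgebra of `V` containing a given object: two
`κ`-presentable objects `fst ⟶ snd` over `V`, such that the structure map of `V` restricts to
a morphism `fst ⟶ F snd`. -/
structure Stage (V : Coalgebra F) (κ : Cardinal.{v}) [Fact κ.IsRegular] where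
  /-- the first object -/
  fst : 𝒞
  /-- the second object -/
  snd : 𝒞
  /-- the morphism from the first object to the second -/
  hom : fst ⟶ snd
  /-- the restriction of the structure map -/
  str : fst ⟶ F.obj snd
  /-- the morphism to `V` -/
  toV : snd ⟶ V.V
  presentable_fst : IsCardinalPresentable fst κ
  presentable_snd : IsCardinalPresentable snd κ
  str_map : str ≫ F.map toV = hom ≫ toV ≫ V.str

variable {V : Coalgebra F} {κ : Cardinal.{v}} [Fact κ.IsRegular]

/-- The colimit of a sequence of presentable objects over `V`, with compatible restrictions of the
structure map of `V`, is a coalgebra over `V`. -/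
lemma exists_of_sequence [IsCardinalLocallyPresentable 𝒞 κ] (hκ : Cardinal.aleph0 < κ)
    (X : ℕ → 𝒞) (x : ∀ n, X n ⟶ V.V) (m : ∀ n, X n ⟶ X (n + 1))
    (s : ∀ n, X n ⟶ F.obj (X (n + 1))) (hX : ∀ n, IsCardinalPresentable (X n) κ)
    (hmx : ∀ n, m n ≫ x (n + 1) = x n) (hms : ∀ n, m n ≫ s (n + 1) = s n ≫ F.map (m (n + 1)))
    (hsx : ∀ n, s n ≫ F.map (x (n + 1)) = x n ≫ V.str) :
    ∃ (W : Coalgebra F) (d : W ⟶ V) (ι : ∀ n, X n ⟶ W.V),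
      IsCardinalPresentable W.V κ ∧ (∀ n, ι n ≫ d.f = x n) ∧ (∀ n, m n ≫ ι (n + 1) = ι n) ∧
      ∀ n, ι n ≫ W.str = s n ≫ F.map (ι (n + 1)) := by
  have : HasColimitsOfSize.{0, 0} 𝒞 := hasColimitsOfSizeShrink.{0, 0, v, v} 𝒞
  let D : ℕ ⥤ 𝒞 := Functor.ofSequence m
  have hD (n : ℕ) : D.map (homOfLE n.le_succ) = m n := Functor.ofSequence_map_homOfLE_succ m n
  obtain ⟨c, ⟨hc⟩⟩ : ∃ c : Cocone D, Nonempty (IsColimit c) := ⟨_, ⟨colimit.isColimit D⟩⟩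
  obtain ⟨ι, hι⟩ : ∃ ι : ∀ n, X n ⟶ c.pt, ∀ n, ι n = c.ι.app n :=
    ⟨fun n => c.ι.app n, fun _ => rfl⟩
  have hm (n : ℕ) : m n ≫ ι (n + 1) = ι n := by
    rw [hι, hι, ← c.w (homOfLE n.le_succ), hD]
    rfl
  have ext {Y : 𝒞} {y z : c.pt ⟶ Y} (h : ∀ n, ι n ≫ y = ι n ≫ z) : y = z :=
    hc.hom_ext fun n => by
      have h := h n
      rw [hι] at h
      exact h
  have desc {Y : 𝒞} (y : ∀ n, X n ⟶ Y) (hy : ∀ n, m n ≫ y (n + 1) = y n) :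
      ∃ z : c.pt ⟶ Y, ∀ n, ι n ≫ z = y n := by
    let s : Cocone D :=
      { pt := Y
        ι := NatTrans.ofSequence y fun n => by
          rw [hD]
          exact (hy n).trans (Category.comp_id _).symm }
    exact ⟨hc.desc s, fun n => by rw [hι]; exact hc.fac s n⟩
  have (n : ℕ) : IsCardinalPresentable (D.obj n) κ := hX n
  have hp : IsCardinalPresentable c.pt κ :=
    isCardinalPresentable_of_isColimit c hc κ (hasCardinalLT_arrow_nat hκ)
  obtain ⟨d, hd⟩ := desc x hmx
  obtain ⟨t, ht⟩ := desc (fun n => s n ≫ F.map (ι (n + 1))) (fun n => by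
    rw [reassoc_of% hms, ← F.map_comp, hm])
  refine ⟨⟨c.pt, t⟩, ⟨d, ext fun n => ?_⟩, ι, hp, hd, hm, ht⟩
  rw [reassoc_of% ht, reassoc_of% hd, ← F.map_comp, hd, hsx]

lemma Stage.exists_succ [IsCardinalLocallyPresentable 𝒞 κ] [F.IsCardinalAccessible κ]
    (S : Stage V κ) : ∃ (Z : 𝒞) (n : S.snd ⟶ Z) (t : S.snd ⟶ F.obj Z) (z : Z ⟶ V.V),
      IsCardinalPresentable Z κ ∧ t ≫ F.map z = n ≫ z ≫ V.str ∧ n ≫ z = S.toV ∧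
      S.hom ≫ t = S.str ≫ F.map n := by
  have := S.presentable_fst
  have := S.presentable_snd
  obtain ⟨P, _, hP⟩ := HasCardinalFilteredGenerator.exists_generator 𝒞 κ
  obtain ⟨J, _, _, ⟨p⟩⟩ := hP.exists_colimitsOfShape V.V
  have := isFiltered_of_isCardinalFiltered J κ
  have := F.preservesColimitsOfShape_of_isCardinalAccessible κ J
  let c : Cocone p.diag := ⟨V.V, p.ι⟩
  have hc : IsColimit c := p.isColimit
  have hc' : IsColimit (F.mapCocone c) := isColimitOfPreserves F hc
  have hw {i j : J} (f : i ⟶ j) : p.diag.map f ≫ p.ι.app j = p.ι.app i := c.w f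
  obtain ⟨i, y, hy⟩ := IsCardinalPresentable.exists_hom_of_isColimit κ hc S.toV
  obtain ⟨j, t, ht⟩ := IsCardinalPresentable.exists_hom_of_isColimit κ hc' (S.toV ≫ V.str)
  change S.snd ⟶ F.obj (p.diag.obj j) at t
  replace hy : y ≫ p.ι.app i = S.toV := hy
  replace ht : t ≫ F.map (p.ι.app j) = S.toV ≫ V.str := ht
  let k := IsFiltered.max i j
  let a : i ⟶ k := IsFiltered.leftToMax i j
  let b : j ⟶ k := IsFiltered.rightToMax i j
  obtain ⟨l, f, hf⟩ := IsCardinalPresentable.exists_eq_of_isColimit' κ hc' (i := k)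
    (S.hom ≫ t ≫ F.map (p.diag.map b)) (S.str ≫ F.map (y ≫ p.diag.map a)) (by
      change _ ≫ F.map (p.ι.app k) = _ ≫ F.map (p.ι.app k)
      rw [Category.assoc, Category.assoc, Category.assoc, ← F.map_comp, ← F.map_comp,
        Category.assoc, hw, hw, ht, hy, S.str_map])
  refine ⟨p.diag.obj l, y ≫ p.diag.map a ≫ p.diag.map f,
    t ≫ F.map (p.diag.map b) ≫ F.map (p.diag.map f), p.ι.app l,
    hP.le_isCardinalPresentable _ (p.prop_diag_obj l), ?_, ?_, ?_⟩
  · rw [Category.assoc, Category.assoc, Category.assoc, Category.assoc, ← F.map_comp,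
      ← F.map_comp, hw, hw, ht,
      ← reassoc_of% hy, ← hw a, ← hw f, Category.assoc, Category.assoc]
  · rw [Category.assoc, Category.assoc, hw, hw, hy]
  · simpa using hf

section

variable [IsCardinalLocallyPresentable 𝒞 κ] [F.IsCardinalAccessible κ]

/-- The next stage. -/
noncomputable abbrev Stage.succ (S : Stage V κ) : Stage V κ where
  fst := S.snd
  snd := S.exists_succ.choose
  hom := S.exists_succ.choose_spec.choose
  str := S.exists_succ.choose_spec.choose_spec.choose
  toV := S.exists_succ.choose_spec.choose_spec.choose_spec.choose
  presentable_fst := S.presentable_snd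
  presentable_snd := S.exists_succ.choose_spec.choose_spec.choose_spec.choose_spec.1
  str_map := S.exists_succ.choose_spec.choose_spec.choose_spec.choose_spec.2.1

lemma Stage.succ_hom_toV (S : Stage V κ) : S.succ.hom ≫ S.succ.toV = S.toV :=
  S.exists_succ.choose_spec.choose_spec.choose_spec.choose_spec.2.2.1

lemma Stage.hom_succ_str (S : Stage V κ) : S.hom ≫ S.succ.str = S.str ≫ F.map S.succ.hom :=
  S.exists_succ.choose_spec.choose_spec.choose_spec.choose_spec.2.2.2

/-- The sequence of stages starting with a given one. -/
noncomputable def Stage.seq (S : Stage V κ) : ℕ → Stage V κ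
  | 0 => S
  | n + 1 => (seq S n).succ

/-- Given a homomorphism `d : W ⟶ V` of coalgebras and a factorization `W ⟶ P ⟶ V` in `𝒞`,
with `W` and `P` presentable, there is a coalgebra `W'` over `V` with presentable carrier
and a morphism `P ⟶ W'` over `V` such that the composition `W ⟶ P ⟶ W'` is a homomorphism. -/
lemma exists_factorization (hκ : Cardinal.aleph0 < κ) {W : Coalgebra F} (d : W ⟶ V) {P : 𝒞}
    [IsCardinalPresentable W.V κ] [IsCardinalPresentable P κ] (g : W.V ⟶ P) (p : P ⟶ V.V)
    (hp : g ≫ p = d.f) :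
    ∃ (W' : Coalgebra F) (d' : W' ⟶ V) (q : P ⟶ W'.V) (w : W ⟶ W'),
      IsCardinalPresentable W'.V κ ∧ q ≫ d'.f = p ∧ g ≫ q = w.f := by
  let S : Stage V κ :=
    { fst := W.V
      snd := P
      hom := g
      str := W.str ≫ F.map g
      toV := p
      presentable_fst := inferInstance
      presentable_snd := inferInstance
      str_map := by rw [Category.assoc, ← F.map_comp, hp, reassoc_of% hp, d.h] }
  obtain ⟨W', d', ι, hW', hd, hm, hs⟩ := exists_of_sequence (V := V) (κ := κ) hκ
    (fun n => (S.seq n).fst) (fun n => (S.seq n).hom ≫ (S.seq n).toV)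
    (fun n => (S.seq n).hom) (fun n => (S.seq n).str) (fun n => (S.seq n).presentable_fst)
    (fun n => congrArg ((S.seq n).hom ≫ ·) (S.seq n).succ_hom_toV)
    (fun n => (S.seq n).hom_succ_str)
    (fun n => by
      refine Eq.trans ?_ ((S.seq n).str_map.trans (Category.assoc _ _ _).symm)
      exact congrArg (fun z => (S.seq n).str ≫ F.map z) (S.seq n).succ_hom_toV)
  have h : ∃ (ι₀ : W.V ⟶ W'.V) (ι₁ : P ⟶ W'.V), g ≫ ι₁ = ι₀ ∧ ι₁ ≫ d'.f = p ∧
      ι₀ ≫ W'.str = (W.str ≫ F.map g) ≫ F.map ι₁ :=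
    ⟨ι 0, ι 1, hm 0, (hd 1).trans S.succ_hom_toV, hs 0⟩
  obtain ⟨ι₀, ι₁, rfl, h₁, h₂⟩ := h
  refine ⟨W', d', ι₁, ⟨g ≫ ι₁, ?_⟩, hW', h₁, rfl⟩
  rw [F.map_comp, h₂, Category.assoc]

end

end Endofunctor.Coalgebra

end CategoryTheory

namespace MeasuringCoalgebra

open Endofunctor

variable {𝒞 : Type u} [Category.{v} 𝒞] [MonoidalCategory 𝒞] {F : 𝒞 ⥤ 𝒞} [F.LaxMonoidal]

/-- Precomposing a measuring with a coalgebra homomorphism gives a measuring. -/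
lemma IsMeasuring.restrict {C D : Coalgebra F} {A B : Algebra F} {φ : D.V ⊗ A.a ⟶ B.a}
    (h : IsMeasuring D A B φ) (d : C ⟶ D) : IsMeasuring C A B (d.f ▷ A.a ≫ φ) := by
  unfold IsMeasuring at h ⊢
  rw [F.map_comp, Category.assoc, ← Functor.LaxMonoidal.μ_natural_left_assoc,
    ← comp_whiskerRight_assoc, d.h, comp_whiskerRight_assoc, h, whisker_exchange_assoc]

namespace Measuring

variable {A B : Algebra F}

variable (A B) in
/-- The coalgebra of a measuring, as a functor. -/
@[simps]
def forget : Measuring A B ⥤ Coalgebra F where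
  obj M := M.coalg
  map f := f.hom

/-- The restriction of a measuring along a coalgebra homomorphism. -/
@[simps]
def restrict (M : Measuring A B) {C : Coalgebra F} (d : C ⟶ M.coalg) : Measuring A B where
  coalg := C
  map := d.f ▷ A.a ≫ M.map
  isMeasuring := M.isMeasuring.restrict d

section Colimits

variable {J : Type*} [Category* J]

/-- A morphism `V ⊗ A ⟶ B` out of a colimit `V` of coalgebras is a measuring if its restrictions
are. -/
lemma _root_.MeasuringCoalgebra.IsMeasuring.of_isColimit {K : J ⥤ Coalgebra F} {c : Cocone K}
    (hc : IsColimit ((Coalgebra.forget F ⋙ tensorRight (F.obj A.a)).mapCocone c))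
    (φ : c.pt.V ⊗ A.a ⟶ B.a)
    (h : ∀ j, IsMeasuring (K.obj j) A B (Coalgebra.Hom.f (V₁ := c.pt) (c.ι.app j) ▷ A.a ≫ φ)) :
    IsMeasuring c.pt A B φ := by
  obtain ⟨ι, hι⟩ : ∃ ι : ∀ j, K.obj j ⟶ c.pt, ∀ j, ι j = c.ι.app j :=
    ⟨fun j => c.ι.app j, fun _ => rfl⟩
  have ext {Y : 𝒞} {y z : c.pt.V ⊗ F.obj A.a ⟶ Y}
      (w : ∀ j, (ι j).f ▷ F.obj A.a ≫ y = (ι j).f ▷ F.obj A.a ≫ z) : y = z :=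
    hc.hom_ext fun j => by
      have h := w j
      rw [hι] at h
      exact h
  refine ext fun j => ?_
  have h := h j
  rw [← hι] at h
  unfold IsMeasuring at h
  rw [F.map_comp, Category.assoc, ← Functor.LaxMonoidal.μ_natural_left_assoc,
    ← comp_whiskerRight_assoc, (ι j).h, comp_whiskerRight_assoc] at h
  rw [h, whisker_exchange_assoc]

variable [∀ X : 𝒞, PreservesColimitsOfShape J (tensorRight X)] [HasColimitsOfShape J 𝒞]

lemma hasColimitsOfShape : HasColimitsOfShape J (Measuring A B) where
  has_colimit K := by
    obtain ⟨c, ⟨hc⟩⟩ : ∃ c : Cocone (K ⋙ forget A B), Nonempty (IsColimit c) :=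
      ⟨_, ⟨colimit.isColimit _⟩⟩
    have hA := isColimitOfPreserves (Coalgebra.forget F ⋙ tensorRight A.a) hc
    obtain ⟨ι, hι⟩ : ∃ ι : ∀ j, (K.obj j).coalg ⟶ c.pt, ∀ j, ι j = c.ι.app j :=
      ⟨fun j => c.ι.app j, fun _ => rfl⟩
    have hw {i j : J} (f : i ⟶ j) : (K.map f).hom ≫ ι j = ι i := by
      rw [hι, hι]
      exact c.w f
    have ext {Y : 𝒞} {y z : c.pt.V ⊗ A.a ⟶ Y}
        (w : ∀ j, (ι j).f ▷ A.a ≫ y = (ι j).f ▷ A.a ≫ z) : y = z :=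
      hA.hom_ext fun j => by
        have h := w j
        rw [hι] at h
        exact h
    obtain ⟨φ, hφ⟩ : ∃ φ : c.pt.V ⊗ A.a ⟶ B.a, ∀ j, (ι j).f ▷ A.a ≫ φ = (K.obj j).map :=
      ⟨hA.desc ⟨B.a, { app := fun j => (K.obj j).map
                       naturality := fun _ _ f => (K.map f).comm.trans (Category.comp_id _).symm }⟩,
        fun j => by
          rw [hι]
          exact hA.fac _ j⟩
    let M : Measuring A B :=
      { coalg := c.pt
        map := φ
        isMeasuring := .of_isColimit (isColimitOfPreserves _ hc) φ fun j => by
          have h := (K.obj j).isMeasuring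
          rw [← hφ, hι] at h
          exact h }
    let s : Cocone K :=
      { pt := M
        ι :=
          { app := fun j => ⟨ι j, hφ j⟩
            naturality := fun i j f => Hom.ext ((hw f).trans (Category.comp_id _).symm) } }
    refine HasColimit.mk ⟨s, ?_⟩
    have hd (t : Cocone K) : ∃ d : c.pt ⟶ t.pt.coalg,
        ∀ j, ι j ≫ d = Hom.hom (M' := t.pt) (t.ι.app j) :=
      ⟨hc.desc ((forget A B).mapCocone t), fun j => by
        rw [hι]
        exact hc.fac _ j⟩
    choose d hd using hd
    exact
      { desc t := ⟨d t, ext fun j => by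
          have h : ((ι j).f ≫ (d t).f) ▷ A.a ≫ t.pt.map = (K.obj j).map :=
            (congrArg (fun e : (K.obj j).coalg ⟶ t.pt.coalg => e.f ▷ A.a ≫ t.pt.map)
              (hd t j)).trans (Hom.comm (M' := t.pt) (t.ι.app j))
          rw [comp_whiskerRight, Category.assoc] at h
          exact h.trans (hφ j).symm⟩
        fac t j := Hom.ext (hd t j)
        uniq t m hm := Hom.ext (hc.hom_ext fun j => by
          have h := (congrArg Hom.hom (hm j)).trans (hd t j).symm
          rw [← hι]
          exact h) }

end Colimits

section Presentable

variable (κ : Cardinal.{v}) [Fact κ.IsRegular]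

variable (A B) in
/-- The property of measurings that the carrier of the coalgebra is `κ`-presentable. -/
def presentable : ObjectProperty (Measuring A B) :=
  fun M => IsCardinalPresentable M.coalg.V κ

instance [IsCardinalLocallyPresentable 𝒞 κ] :
    ObjectProperty.EssentiallySmall.{v} (presentable A B κ) := by
  apply ObjectProperty.EssentiallySmall.of_functor _ (forget A B ⋙ Coalgebra.forget F)
  · refine ObjectProperty.EssentiallySmall.of_le (Q := isCardinalPresentable 𝒞 κ) ?_
    rintro X ⟨M, hM, ⟨e⟩⟩
    have : IsCardinalPresentable ((forget A B ⋙ Coalgebra.forget F).obj M) κ := hM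
    exact isCardinalPresentable_of_iso e κ
  · intro Y
    let S := Σ s : Y ⟶ F.obj Y, { φ : Y ⊗ A.a ⟶ B.a // IsMeasuring ⟨Y, s⟩ A B φ }
    refine ⟨.ofObj fun s : S => (⟨⟨Y, s.1⟩, s.2.1, s.2.2⟩ : Measuring A B), inferInstance, ?_⟩
    rintro M ⟨-, ⟨e⟩⟩
    let e : M.coalg.V ≅ Y := e
    let i : (⟨Y, e.inv ≫ M.coalg.str ≫ F.map e.hom⟩ : Coalgebra F) ≅ M.coalg :=
      Coalgebra.isoMk e.symm (by simp [← F.map_comp])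
    refine ⟨_, ⟨(⟨_, (M.restrict i.hom).map, (M.restrict i.hom).isMeasuring⟩ : S)⟩, ⟨?_⟩⟩
    exact
      { hom := ⟨i.inv, by
          change i.inv.f ▷ A.a ≫ i.hom.f ▷ A.a ≫ M.map = M.map
          rw [← comp_whiskerRight_assoc, ← Coalgebra.comp_f, i.inv_hom_id]
          simp⟩
        inv := ⟨i.hom, rfl⟩
        hom_inv_id := Hom.ext i.inv_hom_id
        inv_hom_id := Hom.ext i.hom_inv_id }

end Presentable

end Measuring
end MeasuringCoalgebra

namespace CategoryTheory.Endofunctor.Coalgebra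

variable {𝒞 : Type u} [Category.{v} 𝒞] {F : 𝒞 ⥤ 𝒞} {κ : Cardinal.{v}} [Fact κ.IsRegular]
  [IsCardinalLocallyPresentable 𝒞 κ] {V : Coalgebra F}

lemma isCardinalPresentable_of_isColimit_of_finite {J : Type} [SmallCategory J] [FinCategory J]
    {K : J ⥤ Coalgebra F} (hK : ∀ j, IsCardinalPresentable (K.obj j).V κ) {c : Cocone K}
    (hc : IsColimit c) : IsCardinalPresentable c.pt.V κ := by
  have : HasColimitsOfSize.{0, 0} 𝒞 := hasColimitsOfSizeShrink.{0, 0, v, v} 𝒞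
  have (j : J) : IsCardinalPresentable ((K ⋙ forget F).obj j) κ := hK j
  exact isCardinalPresentable_of_isColimit _ (isColimitOfPreserves (forget F) hc) κ
    (hasCardinalLT_of_finite _ _ (Cardinal.IsRegular.aleph0_le Fact.out))

variable [F.IsCardinalAccessible κ]

/-- Every morphism from a presentable object to a coalgebra factors through a
coalgebra homomorphism with presentable source. -/
lemma exists_hom_of_isCardinalPresentable (hκ : Cardinal.aleph0 < κ) {P : 𝒞}
    [IsCardinalPresentable P κ] (p : P ⟶ V.V) :
    ∃ (W : Coalgebra F) (d : W ⟶ V) (q : P ⟶ W.V), IsCardinalPresentable W.V κ ∧ q ≫ d.f = p := by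
  have : HasColimitsOfSize.{0, 0} 𝒞 := hasColimitsOfSizeShrink.{0, 0, v, v} 𝒞
  have hi : IsInitial (⊥_ (Coalgebra F)).V :=
    IsInitial.isInitialObj (forget F) (⊥_ (Coalgebra F)) initialIsInitial
  have : IsCardinalPresentable (⊥_ (Coalgebra F)).V κ :=
    isCardinalPresentable_of_isColimit_of_finite (K := Functor.empty.{0} (Coalgebra F))
      (fun j => j.as.elim) (colimit.isColimit _)
  obtain ⟨W, d, q, _, hW, hq, _⟩ := exists_factorization hκ (initial.to V) (hi.to P) p
    (hi.hom_ext _ _)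
  exact ⟨W, d, q, hW, hq⟩

/-- Two factorizations of a morphism through coalgebra homomorphisms with presentable sources
are connected. -/
lemma exists_hom_of_eq (hκ : Cardinal.aleph0 < κ) {P : 𝒞} [IsCardinalPresentable P κ]
    {W W' : Coalgebra F} [IsCardinalPresentable W.V κ] [IsCardinalPresentable W'.V κ]
    (d : W ⟶ V) (d' : W' ⟶ V) (q : P ⟶ W.V) (q' : P ⟶ W'.V) (h : q ≫ d.f = q' ≫ d'.f) :
    ∃ (X : Coalgebra F) (e : X ⟶ V) (w : W ⟶ X) (w' : W' ⟶ X),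
      IsCardinalPresentable X.V κ ∧ w ≫ e = d ∧ w' ≫ e = d' ∧ q ≫ w.f = q' ≫ w'.f := by
  have : HasColimitsOfSize.{0, 0} 𝒞 := hasColimitsOfSizeShrink.{0, 0, v, v} 𝒞
  have hX : IsCardinalPresentable (W ⨿ W').V κ :=
    isCardinalPresentable_of_isColimit_of_finite (K := pair W W')
      (by rintro (_ | _) <;> assumption) (colimit.isColimit _)
  let i : W ⟶ W ⨿ W' := coprod.inl
  let i' : W' ⟶ W ⨿ W' := coprod.inr
  let e : W ⨿ W' ⟶ V := coprod.desc d d'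
  have he : i ≫ e = d := coprod.inl_desc _ _
  have he' : i' ≫ e = d' := coprod.inr_desc _ _
  let g := coequalizer.π (q ≫ i.f) (q' ≫ i'.f)
  have hQ : IsCardinalPresentable (coequalizer (q ≫ i.f) (q' ≫ i'.f)) κ := by
    have (j : WalkingParallelPair) :
        IsCardinalPresentable ((parallelPair (q ≫ i.f) (q' ≫ i'.f)).obj j) κ := by
      rcases j with _ | _ <;> assumption
    exact isCardinalPresentable_of_isColimit _
      (colimit.isColimit (parallelPair (q ≫ i.f) (q' ≫ i'.f))) κ
      (hasCardinalLT_of_finite _ _ (Cardinal.IsRegular.aleph0_le Fact.out))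
  have hg : q ≫ i.f ≫ g = q' ≫ i'.f ≫ g := by
    simpa using coequalizer.condition (q ≫ i.f) (q' ≫ i'.f)
  have hp : (q ≫ i.f) ≫ e.f = (q' ≫ i'.f) ≫ e.f := by
    rw [Category.assoc, Category.assoc, ← comp_f, ← comp_f, he, he', h]
  obtain ⟨X, x, r, w, hX', hr, hw⟩ :=
    exists_factorization hκ e g (coequalizer.desc e.f hp) (coequalizer.π_desc _ _)
  have hwx : w ≫ x = e := by
    apply Coalgebra.ext
    rw [comp_f, ← hw, Category.assoc, hr]
    exact coequalizer.π_desc _ _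
  refine ⟨X, x, i ≫ w, i' ≫ w, hX', by rw [Category.assoc, hwx, he],
    by rw [Category.assoc, hwx, he'], ?_⟩
  rw [comp_f, comp_f, ← hw, reassoc_of% hg]

end CategoryTheory.Endofunctor.Coalgebra

namespace MeasuringCoalgebra

open Endofunctor

variable {𝒞 : Type u} [Category.{v} 𝒞] [MonoidalCategory 𝒞] {F : 𝒞 ⥤ 𝒞} [F.LaxMonoidal]

namespace Measuring

variable {A B : Algebra F} {κ : Cardinal.{v}} [Fact κ.IsRegular]
  [IsCardinalLocallyPresentable 𝒞 κ] [F.IsCardinalAccessible κ]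
  [∀ X : 𝒞, PreservesColimitsOfSize.{v, v} (tensorRight X)]

/-- A measuring that receives a natural morphism from the measurings with presentable carriers
receives a morphism from every measuring. -/
lemma nonempty_hom_of_presentable (hκ : Cardinal.aleph0 < κ) {T : Measuring A B}
    (τ : ∀ W : Measuring A B, presentable A B κ W → (W ⟶ T))
    (hτ : ∀ {W W' : Measuring A B} (hW : presentable A B κ W) (hW' : presentable A B κ W')
      (f : W ⟶ W'), f ≫ τ W' hW' = τ W hW) (M : Measuring A B) : Nonempty (M ⟶ T) := by
  obtain ⟨P, _, hP⟩ := HasCardinalFilteredGenerator.exists_generator 𝒞 κ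
  obtain ⟨J, _, _, ⟨p⟩⟩ := hP.exists_colimitsOfShape M.coalg.V
  have hw {i j : J} (f : i ⟶ j) : p.diag.map f ≫ p.ι.app j = p.ι.app i := p.w f
  have hp (j : J) : IsCardinalPresentable (p.diag.obj j) κ :=
    hP.le_isCardinalPresentable _ (p.prop_diag_obj j)
  choose W d q hW hq using fun j => Coalgebra.exists_hom_of_isCardinalPresentable hκ (p.ι.app j)
  let t {C : Coalgebra F} (hC : IsCardinalPresentable C.V κ) (e : C ⟶ M.coalg) : C ⟶ T.coalg :=
    (τ (M.restrict e) hC).hom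
  have htw {C : Coalgebra F} (hC : IsCardinalPresentable C.V κ) (e : C ⟶ M.coalg) :
      (t hC e).f ▷ A.a ≫ T.map = e.f ▷ A.a ≫ M.map := (τ (M.restrict e) hC).comm
  have ht {C C' : Coalgebra F} (hC : IsCardinalPresentable C.V κ)
      (hC' : IsCardinalPresentable C'.V κ) (e : C ⟶ M.coalg) (e' : C' ⟶ M.coalg) (f : C ⟶ C')
      (hf : f ≫ e' = e) : f ≫ t hC' e' = t hC e := by
    subst hf
    exact congrArg Hom.hom (hτ (W := M.restrict (f ≫ e')) (W' := M.restrict e') hC hC'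
      ⟨f, by
        change f.f ▷ A.a ≫ e'.f ▷ A.a ≫ M.map = (f ≫ e').f ▷ A.a ≫ M.map
        rw [Coalgebra.comp_f, comp_whiskerRight_assoc]⟩)
  have key {X : 𝒞} [IsCardinalPresentable X κ] {C C' : Coalgebra F}
      (hC : IsCardinalPresentable C.V κ) (hC' : IsCardinalPresentable C'.V κ) (e : C ⟶ M.coalg)
      (e' : C' ⟶ M.coalg) (r : X ⟶ C.V) (r' : X ⟶ C'.V) (h : r ≫ e.f = r' ≫ e'.f) :
      r ≫ (t hC e).f = r' ≫ (t hC' e').f := by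
    obtain ⟨Y, y, w, w', hY, hwy, hwy', hr⟩ := Coalgebra.exists_hom_of_eq hκ e e' r r' h
    rw [← ht hC hY e y w hwy, ← ht hC' hY e' y w' hwy', Coalgebra.comp_f, Coalgebra.comp_f,
      reassoc_of% hr]
  obtain ⟨h, hh⟩ : ∃ h : M.coalg.V ⟶ T.coalg.V,
      ∀ j, p.ι.app j ≫ h = q j ≫ (t (hW j) (d j)).f :=
    ⟨p.isColimit.desc ⟨T.coalg.V,
      { app := fun j => q j ≫ (t (hW j) (d j)).f
        naturality := fun i j f => by
          refine Eq.trans ?_ (Category.comp_id _).symm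
          rw [← Category.assoc]
          apply key
          rw [Category.assoc, hq, hq, hw] }⟩, fun j => p.isColimit.fac _ j⟩
  have hdh {C : Coalgebra F} (hC : IsCardinalPresentable C.V κ) (e : C ⟶ M.coalg) :
      e.f ≫ h = (t hC e).f := by
    obtain ⟨j, r, hr⟩ := IsCardinalPresentable.exists_hom_of_isColimit κ p.isColimit e.f
    replace hr : r ≫ p.ι.app j = e.f := hr
    rw [← hr, Category.assoc, hh, ← Category.assoc, key (hW j) hC (d j) e (r ≫ q j) (𝟙 _),
      Category.id_comp]
    rw [Category.assoc, hq, hr, Category.id_comp]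
  have ext {Y : 𝒞} {y z : M.coalg.V ⟶ Y} (w : ∀ j, p.ι.app j ≫ y = p.ι.app j ≫ z) : y = z :=
    p.isColimit.hom_ext w
  have ext' {Y : 𝒞} {y z : M.coalg.V ⊗ A.a ⟶ Y}
      (w : ∀ j, p.ι.app j ▷ A.a ≫ y = p.ι.app j ▷ A.a ≫ z) : y = z :=
    (isColimitOfPreserves (tensorRight A.a) p.isColimit).hom_ext w
  refine ⟨⟨⟨h, ext fun j => ?_⟩, ext' fun j => ?_⟩⟩
  · rw [← hq, Category.assoc, ← Coalgebra.Hom.h_assoc, ← F.map_comp, Category.assoc,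
      reassoc_of% (hdh (hW j) (d j)), hdh (hW j) (d j), Coalgebra.Hom.h]
  · rw [← comp_whiskerRight_assoc, hh, comp_whiskerRight_assoc, htw,
      ← comp_whiskerRight_assoc, hq]

lemma hasTerminal (hκ : Cardinal.aleph0 < κ) : HasTerminal (Measuring A B) := by
  have : HasColimitsOfSize.{v, v} (Measuring A B) :=
    ⟨fun _ _ => hasColimitsOfShape⟩
  have : HasColimitsOfShape (SmallModel.{v} (presentable A B κ).FullSubcategory)
      (Measuring A B) := inferInstance
  have : HasColimitsOfShape (presentable A B κ).FullSubcategory (Measuring A B) :=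
    hasColimitsOfShape_of_equivalence
      (equivSmallModel.{v} (presentable A B κ).FullSubcategory).symm
  let T : Measuring A B := colimit (presentable A B κ).ι
  have hT (M : Measuring A B) : Nonempty (M ⟶ T) :=
    nonempty_hom_of_presentable hκ
      (fun W hW => colimit.ι (presentable A B κ).ι ⟨W, hW⟩)
      (fun hW hW' f => colimit.w (presentable A B κ).ι
        (ObjectProperty.homMk f : (⟨_, hW⟩ : (presentable A B κ).FullSubcategory) ⟶ ⟨_, hW'⟩)) M
  have : HasInitial (Measuring A B)ᵒᵖ :=
    hasInitial_of_weakly_initial_and_hasWideEqualizers (T := op T)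
      fun X => ⟨(hT X.unop).some.op⟩
  exact hasTerminal_of_hasInitial_op

lemma hasTerminal_of_isLocallyPresentable [IsLocallyPresentable.{v} 𝒞] [F.IsAccessible.{v}]
    (A B : Algebra F) : HasTerminal (Measuring A B) := by
  obtain ⟨κ₁, _, _⟩ := IsLocallyPresentable.exists_cardinal 𝒞
  obtain ⟨κ₂, _, _⟩ := Functor.IsAccessible.exists_cardinal (F := F)
  let κ := Order.succ (max κ₁ κ₂)
  have h : Cardinal.aleph0 ≤ max κ₁ κ₂ :=
    (Cardinal.IsRegular.aleph0_le (Fact.out : κ₁.IsRegular)).trans (le_max_left _ _)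
  have : Fact κ.IsRegular := ⟨Cardinal.isRegular_succ h⟩
  have := IsCardinalLocallyPresentable.of_le 𝒞 ((le_max_left κ₁ κ₂).trans (Order.le_succ _))
  have := F.isCardinalAccessible_of_le ((le_max_right κ₁ κ₂).trans (Order.le_succ _))
  exact hasTerminal (κ := κ) (Order.lt_succ_of_le h)

end Measuring
end MeasuringCoalgebra

namespace MeasuringCoalgebra

open Endofunctor

variable {𝒞 : Type u} [Category.{v} 𝒞] [MonoidalCategory 𝒞] [MonoidalClosed 𝒞] {F : 𝒞 ⥤ 𝒞}
  [F.LaxMonoidal]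

/-- A morphism `A ⟶ [C, B]` is an algebra homomorphism iff its transpose is a measuring. -/
lemma isMeasuring_uncurry_iff (C : Coalgebra F) (A B : Algebra F)
    (f : A.a ⟶ (ihom C.V).obj B.a) :
    IsMeasuring C A B (MonoidalClosed.uncurry f) ↔
      F.map f ≫ (convolution C B).str = A.str ≫ f := by
  have h : MonoidalClosed.uncurry (F.map f ≫ (convolution C B).str) =
      C.str ▷ F.obj A.a ≫ Functor.LaxMonoidal.μ F C.V A.a ≫ F.map (MonoidalClosed.uncurry f) ≫
        B.str := by
    dsimp only
    rw [← Category.assoc (laxClosed _ _ _), ← Category.assoc (F.map f),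
      MonoidalClosed.uncurry_natural_right, ← Category.assoc (F.map f),
      MonoidalClosed.uncurry_pre_app, MonoidalClosed.uncurry_natural_left, laxClosed,
      MonoidalClosed.uncurry_curry, Functor.LaxMonoidal.μ_natural_right_assoc, ← F.map_comp,
      MonoidalClosed.uncurry_eq]
    simp only [Category.assoc]
  rw [← MonoidalClosed.uncurry_injective.eq_iff, h, MonoidalClosed.uncurry_natural_left]
  rfl

variable (C : Coalgebra F) (A B : Algebra F)

/-- Algebra homomorphisms `A ⟶ [C, B]` correspond to coalgebra homomorphisms `C ⟶ Alg(A, B)`. -/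
noncomputable def homConvolutionEquiv (U : UniversalMeasuring A B) :
    (A ⟶ convolution C B) ≃ (C ⟶ U.obj.coalg) where
  toFun f := U.lift ((isMeasuring_uncurry_iff C A B f.f).2 f.h)
  invFun d :=
    { f := MonoidalClosed.curry (d.f ▷ A.a ≫ U.obj.map)
      h := (isMeasuring_uncurry_iff C A B _).1 (by
        rw [MonoidalClosed.uncurry_curry]
        exact U.obj.isMeasuring.restrict d) }
  left_inv f := by
    ext
    dsimp only
    rw [U.lift_comm, MonoidalClosed.curry_uncurry]
  right_inv d := by
    symm
    apply U.lift_unique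
    rw [MonoidalClosed.uncurry_curry]

/-- The sections of a functor on a category with an initial object `N` are its values at `N`. -/
@[simps]
def _root_.CategoryTheory.Limits.IsInitial.sectionsEquiv {𝒟 : Type*} [Category* 𝒟] {N : 𝒟}
    (hN : IsInitial N) (G : 𝒟 ⥤ Type*) : G.sections ≃ G.obj N where
  toFun s := s.1 N
  invFun x := ⟨fun X => G.map (hN.to X) x, fun {X Y} f => by
    dsimp only
    rw [← hN.hom_ext (hN.to X ≫ f) (hN.to Y)]
    exact (Functor.map_comp_apply G _ _ x).symm⟩
  left_inv s := Subtype.ext (funext fun X => s.2 (hN.to X))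
  right_inv x := by
    dsimp only
    rw [← hN.hom_ext (𝟙 N) (hN.to N)]
    simp

variable {N : Algebra F} (hN : IsInitial N) (U : ∀ A B : Algebra F, UniversalMeasuring A B)

/-- Coalgebra homomorphisms `C ⟶ Alg(A, N)` correspond to compatible families of
homomorphisms `C ⟶ Alg(A, X)`. -/
noncomputable def sectionsHomCoalgebraEquiv :
    (weightedLimitPresheaf U C).obj (op A) ≃ (C ⟶ (U A N).obj.coalg) :=
  hN.sectionsEquiv ((homCoalgebra U).obj (op A) ⋙ coyoneda.obj (op C))

/-- The dual algebra `[C, N]` of `C` represents the presheaf `lim_X CoAlg(C, Alg(-, X))`. -/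
noncomputable def representableBy :
    (weightedLimitPresheaf U C).RepresentableBy (convolution C N) where
  homEquiv {A} := (homConvolutionEquiv C A N (U A N)).trans
    (sectionsHomCoalgebraEquiv C A hN U).symm
  homEquiv_comp {A A'} f g := by
    apply (sectionsHomCoalgebraEquiv C A hN U).injective
    rw [Equiv.trans_apply, Equiv.apply_symm_apply]
    let x := (sectionsHomCoalgebraEquiv C A' hN U).symm (homConvolutionEquiv C A' N (U A' N) g)
    have hx : x.1 N = homConvolutionEquiv C A' N (U A' N) g :=
      (sectionsHomCoalgebraEquiv C A' hN U).apply_symm_apply _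
    have h : sectionsHomCoalgebraEquiv C A hN U ((weightedLimitPresheaf U C).map f.op x) =
        (show C ⟶ (U A' N).obj.coalg from x.1 N) ≫ ((homCoalgebra U).map f.op).app N := rfl
    refine Eq.trans ?_ h.symm
    rw [hx]
    symm
    apply UniversalMeasuring.lift_unique
    have h₁ : (((homCoalgebra U).map f.op).app N).f ▷ A.a ≫ (U A N).obj.map =
        (U A' N).obj.coalg.V ◁ f.f ≫ (U A' N).obj.map ≫ 𝟙 _ :=
      UniversalMeasuring.lift_comm (U A N) _
    have h₂ : (homConvolutionEquiv C A' N (U A' N) g).f ▷ A'.a ≫ (U A' N).obj.map =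
        MonoidalClosed.uncurry g.f :=
      UniversalMeasuring.lift_comm (U A' N) _
    rw [Coalgebra.comp_f, comp_whiskerRight, Category.assoc, h₁, Category.comp_id,
      ← whisker_exchange_assoc, h₂, ← MonoidalClosed.uncurry_natural_left]
    rfl

end MeasuringCoalgebra

theorem mainTheorem7 {𝒞 : Type u} [Category.{v} 𝒞] [MonoidalCategory 𝒞] [SymmetricCategory 𝒞]
    [MonoidalClosed 𝒞] [IsLocallyPresentable.{v} 𝒞]
    (F : 𝒞 ⥤ 𝒞) [F.LaxBraided] [F.IsAccessible.{v}] :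
    -- the initial algebra and all universal measurings exist
    HasInitial (Endofunctor.Algebra F) ∧
    (∀ A B : Endofunctor.Algebra F, Nonempty (MeasuringCoalgebra.UniversalMeasuring A B)) ∧
    -- and whichever initial algebra `N` and universal measurings are chosen,
    ∀ (N : Endofunctor.Algebra F) (_ : IsInitial N)
      (U : ∀ A B : Endofunctor.Algebra F, MeasuringCoalgebra.UniversalMeasuring A B)
      (C : Endofunctor.Coalgebra F),
      -- `Alg(A, [C, N]) ≅ lim_X CoAlg(C, Alg(A, X))`, naturally in `A`,
      Nonempty ((MeasuringCoalgebra.weightedLimitPresheaf U C).RepresentableBy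
        (MeasuringCoalgebra.convolution C N)) ∧
      -- and every `C`-initial algebra has a unique homomorphism to `[C, N]`
      ∀ A : Endofunctor.Algebra F, MeasuringCoalgebra.IsCInitial U C A →
        Nonempty (Unique (A ⟶ MeasuringCoalgebra.convolution C N)) := by 
  obtain ⟨κ, _, _⟩ := IsLocallyPresentable.exists_cardinal.{v} 𝒞
  have : HasColimitsOfSize.{v, v} 𝒞 := IsCardinalLocallyPresentable.toHasColimitsOfSize κ
  have (X : 𝒞) : PreservesColimitsOfSize.{v, v} (tensorRight X) := inferInstance
  refine ⟨Endofunctor.Coalgebra.hasInitial_algebra_of_isAccessible, fun A B => ?_,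
    fun N hN U C => ⟨⟨MeasuringCoalgebra.representableBy C hN U⟩, fun A hA => ?_⟩⟩
  · have := MeasuringCoalgebra.Measuring.hasTerminal_of_isLocallyPresentable A B
    exact ⟨⟨_, terminalIsTerminal⟩⟩
  · obtain ⟨h⟩ := hA N
    exact ⟨(MeasuringCoalgebra.homConvolutionEquiv C A N (U A N)).unique⟩
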